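/- Let $A$ be a unital associative (real or complex) Banach algebra. Put $Q(A)=\{p\in A: p^2=p\}$ and $\mathcal G(A)=\{(a,b)\in A\times A: aba=a,\ bab=b\}$, with the subspace topologies, and consider the groupoid $\mathcal G(A)\rightrightarrows Q(A)$ with source $\mathbf s(a,b)=ba$, target $\mathbf t(a,b)=ab$, multiplication $(a_1,b_1)\cdot(a_2,b_2)=(a_1a_2,b_2b_1)$ whenever $b_1a_1=a_2b_2$, units $\mathbf 1_p=(p,p)$ and inversion $(a,b)\mapsto(b,a)$. Here a real analytic Banach manifold is a space with an atlas of charts onto open subsets of real Banach spaces (which may vary from chart to chart) with real analytic transition maps. A submanifold is a closed subset which, with its subspace topology, carries a real analytic Banach manifold structure for which the inclusion is real analytic and its tangent maps are injective with complemented ranges. A submersion is a surjective real analytic map whose tangent maps are surjective with complemented kernels. **Theorem.** The set $Q(A)$ is a real analytic submanifold of $A$, the set $\mathcal G(A)$ is a real analytic submanifold of $A\times A$, and with these manifold structures $\mathcal G(A)\rightrightarrows Q(A)$ is a real analytic Banach–Lie groupoid. That is: 1. it is a topological groupoid: $\mathbf s,\mathbf t$ are continuous, open and surjective, the multiplication is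 continuous on the set $\mathcal G(A)^{(2)}$ of composable pairs, the unit map $Q(A)\to\mathcal G(A)$ is a topological embedding, and the inversion is a homeomorphism; 2. $\mathcal G(A)$ and $Q(A)$ are Hausdorff real analytic Banach manifolds; 3. $\mathbf s$ is a submersion, and $\mathbf t$, the unit map and the inversion are real analytic; 4. $\mathcal G(A)^{(2)}$ is a submanifold of $\mathcal G(A)\times\mathcal G(A)$, and the multiplication $\mathcal G(A)^{(2)}\to\mathcal G(A)$ is real analytic. Moreover, this groupoid is locally transitive: for every $p\in Q(A)$ the orbit $\{\mathbf t(g): g\in\mathcal G(A),\ \mathbf s(g)=p\}$ is open in $Q(A)$. Its isotropy group at $\mathbf 1\in Q(A)$, $\{g\in\mathcal G(A):\mathbf s(g)=\mathbf t(g)=\mathbf 1\}$, is a submanifold of $\mathcal G(A)$ and a real analytic Banach–Lie group. The map $(a,b)\mapsto a$ is an isomorphism (of groups and of real analytic manifolds) from it onto the Banach–Lie group $A^\times$ of invertible elements of $A$, which is an open subset of $A$; its inverse is $a\mapsto(a,a^{-1})$. -/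

import Mathlib

universe u v w

noncomputable section

/-! ### Real analytic Banach manifolds

The model space is allowed to vary from chart to chart, so that different connected components
may be modelled on non-isomorphic Banach spaces. -/

/-- A chart of a topological space `X`: a homeomorphism of an open subset of `X` onto an open
subset of some real Banach space `E`, which is part of the chart. -/
structure BanachChart (X : Type v) [TopologicalSpace X] where
  E : Type u
  [normedAddCommGroup : NormedAddCommGroup E]
  [normedSpace : NormedSpace ℝ E]
  [completeSpace : CompleteSpace E]
  hom : OpenPartialHomeomorph X E

attribute [instance] BanachChart.normedAddCommGroup BanachChart.normedSpace
  BanachChart.completeSpace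

/-- The product of two charts. -/
def BanachChart.prod {X : Type v} {Y : Type w} [TopologicalSpace X] [TopologicalSpace Y]
    (c : BanachChart.{u} X) (d : BanachChart.{u} Y) : BanachChart.{u} (X × Y) where
  E := c.E × d.E
  hom := c.hom.prod d.hom

/-- A structure of (not necessarily Hausdorff) real analytic Banach manifold on a topological
space, given by an atlas with real analytic transition maps. -/
structure AnalyticBanachManifold (X : Type v) [TopologicalSpace X] where
  charts : Set (BanachChart.{u} X)
  cover : ∀ x : X, ∃ c ∈ charts, x ∈ c.hom.source
  compat : ∀ c ∈ charts, ∀ d ∈ charts,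
    AnalyticOnNhd ℝ (d.hom ∘ c.hom.symm) (c.hom.target ∩ c.hom.symm ⁻¹' d.hom.source)

namespace AnalyticBanachManifold

section Constructions

variable {X : Type v} {Y : Type w} [TopologicalSpace X] [TopologicalSpace Y]

/-- The product of two real analytic Banach manifolds. -/
def prod (M : AnalyticBanachManifold.{u} X) (N : AnalyticBanachManifold.{u} Y) :
    AnalyticBanachManifold.{u} (X × Y) where
  charts := {e | ∃ c ∈ M.charts, ∃ d ∈ N.charts, e = c.prod d}
  cover := by
    rintro ⟨x, y⟩
    obtain ⟨c, hc, hx⟩ := M.cover x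
    obtain ⟨d, hd, hy⟩ := N.cover y
    exact ⟨c.prod d, ⟨c, hc, d, hd, rfl⟩, hx, hy⟩
  compat := by
    rintro _ ⟨c, hc, d, hd, rfl⟩ _ ⟨c', hc', d', hd', rfl⟩ ⟨y, z⟩ ⟨⟨hy, hz⟩, hy', hz'⟩
    have h1 : AnalyticAt ℝ (c'.hom ∘ c.hom.symm) y := M.compat c hc c' hc' y ⟨hy, hy'⟩
    have h2 : AnalyticAt ℝ (d'.hom ∘ d.hom.symm) z := N.compat d hd d' hd' z ⟨hz, hz'⟩
    have h1' : AnalyticAt ℝ (fun p : c.E × d.E => (c'.hom ∘ c.hom.symm) p.1) (y, z) :=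
      AnalyticAt.fun_comp (f := fun p : c.E × d.E => p.1) (x := (y, z)) h1 analyticAt_fst
    have h2' : AnalyticAt ℝ (fun p : c.E × d.E => (d'.hom ∘ d.hom.symm) p.2) (y, z) :=
      AnalyticAt.fun_comp (f := fun p : c.E × d.E => p.2) (x := (y, z)) h2 analyticAt_snd
    exact h1'.prod h2'

/-- The manifold structure with the single chart `φ`, where `φ` is an open embedding into a
Banach space. -/
def ofOpenEmbedding [Nonempty X] {E : Type u} [NormedAddCommGroup E] [NormedSpace ℝ E]
    [CompleteSpace E] (φ : X → E) (hφ : Topology.IsOpenEmbedding φ) :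
    AnalyticBanachManifold.{u} X where
  charts := {{ E := E, hom := hφ.toOpenPartialHomeomorph φ }}
  cover := fun x => ⟨_, rfl, by simp⟩
  compat := by
    rintro _ rfl _ rfl y ⟨hy, -⟩
    refine analyticAt_id.congr ?_
    filter_upwards [(hφ.toOpenPartialHomeomorph φ).open_target.mem_nhds hy] with z hz
    exact ((hφ.toOpenPartialHomeomorph φ).right_inv hz).symm

/-- A Banach space as a manifold over itself. -/
def ofBanachSpace (E : Type u) [NormedAddCommGroup E] [NormedSpace ℝ E] [CompleteSpace E] :
    AnalyticBanachManifold.{u} E where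
  charts := {{ E := E, hom := OpenPartialHomeomorph.refl E }}
  cover := fun x => ⟨_, rfl, by simp⟩
  compat := by
    rintro _ rfl _ rfl y -
    exact analyticAt_id

/-- The group of invertible elements of a Banach algebra `A`, as an open subset of `A`. -/
def ofUnits (A : Type u) [NormedRing A] [NormedAlgebra ℝ A] [CompleteSpace A] :
    AnalyticBanachManifold.{u} Aˣ :=
  ofOpenEmbedding (Units.val : Aˣ → A) Units.isOpenEmbedding_val

end Constructions

section Maps

variable {X : Type v} {Y : Type w} [TopologicalSpace X] [TopologicalSpace Y]

/-- Real analytic maps between real analytic Banach manifolds. -/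
def IsAnalyticMap (M : AnalyticBanachManifold.{u} X) (N : AnalyticBanachManifold.{u} Y)
    (f : X → Y) : Prop :=
  Continuous f ∧ ∀ c ∈ M.charts, ∀ d ∈ N.charts,
    AnalyticOnNhd ℝ (d.hom ∘ f ∘ c.hom.symm)
      (c.hom.target ∩ c.hom.symm ⁻¹' (f ⁻¹' d.hom.source))

/-- The tangent map of `f` at `x`, read in the charts `c` around `x` and `d` around `f x`. -/
def tangentIn (c : BanachChart.{u} X) (d : BanachChart.{u} Y) (f : X → Y) (x : X) :
    c.E →L[ℝ] d.E :=
  fderiv ℝ (d.hom ∘ f ∘ c.hom.symm) (c.hom x)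

/-- Real analytic submersions: surjective real analytic maps all of whose tangent maps are
surjective with complemented kernel. -/
def IsSubmersion (M : AnalyticBanachManifold.{u} X) (N : AnalyticBanachManifold.{u} Y)
    (f : X → Y) : Prop :=
  Function.Surjective f ∧ IsAnalyticMap M N f ∧
    ∀ x, ∀ c ∈ M.charts, ∀ d ∈ N.charts, x ∈ c.hom.source → f x ∈ d.hom.source →
      Function.Surjective (tangentIn c d f x) ∧
        (LinearMap.ker (tangentIn c d f x).toLinearMap).ClosedComplemented

/-- Real analytic split immersions: real analytic maps all of whose tangent maps are
injective with (closed) complemented range. -/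
def IsSplitImmersion (M : AnalyticBanachManifold.{u} X) (N : AnalyticBanachManifold.{u} Y)
    (f : X → Y) : Prop :=
  IsAnalyticMap M N f ∧
    ∀ x, ∀ c ∈ M.charts, ∀ d ∈ N.charts, x ∈ c.hom.source → f x ∈ d.hom.source →
      Function.Injective (tangentIn c d f x) ∧
        (LinearMap.range (tangentIn c d f x).toLinearMap).ClosedComplemented

/-- The manifold structure `M` on the subset `S` of `Y`, endowed with the subspace topology,
makes `S` a closed split real analytic submanifold of `(Y, N)`. Such an `M` is unique up to
equivalence of atlases. -/
def IsSubmanifold {S : Set Y} (M : AnalyticBanachManifold.{u} S)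
    (N : AnalyticBanachManifold.{u} Y) : Prop :=
  IsClosed S ∧ IsSplitImmersion M N (Subtype.val : S → Y)

/-- A group with a manifold structure is a real analytic Banach-Lie group. -/
structure IsBanachLieGroup {H : Type v} [TopologicalSpace H] [Group H]
    (M : AnalyticBanachManifold.{u} H) : Prop where
  t2 : T2Space H
  analytic_mul : IsAnalyticMap (M.prod M) M (fun p : H × H => p.1 * p.2)
  analytic_inv : IsAnalyticMap M M (fun g : H => g⁻¹)

end Maps

end AnalyticBanachManifold

/-! ### Groupoids -/

/-- A groupoid with set of arrows `G` and set of objects `B`; the product `mul g h` is defined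
when the source of `g` is the target of `h`. -/
structure ArrowGroupoid (G : Type v) (B : Type w) where
  source : G → B
  target : G → B
  mul : (g h : G) → source g = target h → G
  one : B → G
  inv : G → G
  source_mul : ∀ g h e, source (mul g h e) = source h
  target_mul : ∀ g h e, target (mul g h e) = target g
  mul_assoc : ∀ (g h k : G) (e : source g = target h) (e' : source h = target k),
    mul (mul g h e) k ((source_mul g h e).trans e') =
      mul g (mul h k e') (e.trans (target_mul h k e').symm)
  source_one : ∀ x, source (one x) = x
  target_one : ∀ x, target (one x) = x
  mul_one : ∀ g, mul g (one (source g)) (target_one (source g)).symm = g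
  one_mul : ∀ g, mul (one (target g)) g (source_one (target g)) = g
  source_inv : ∀ g, source (inv g) = target g
  target_inv : ∀ g, target (inv g) = source g
  mul_inv : ∀ g, mul g (inv g) (target_inv g).symm = one (target g)
  inv_mul : ∀ g, mul (inv g) g (source_inv g) = one (source g)

namespace ArrowGroupoid

variable {G : Type v} {B : Type w} (𝓖 : ArrowGroupoid G B)

/-- The set of composable pairs of arrows. -/
def composable : Set (G × G) := {p | 𝓖.source p.1 = 𝓖.target p.2}

/-- The multiplication as a map defined on the set of composable pairs. -/
def mulMap (p : 𝓖.composable) : G := 𝓖.mul p.1.1 p.1.2 p.2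

/-- The orbit of an object. -/
def orbit (x : B) : Set B := {y | ∃ g, 𝓖.source g = x ∧ 𝓖.target g = y}

/-- The isotropy group at an object. -/
def isotropy (x : B) : Set G := {g | 𝓖.source g = x ∧ 𝓖.target g = x}

instance isotropyGroup (x : B) : Group (𝓖.isotropy x) where
  mul g h := ⟨𝓖.mul g.1 h.1 (g.2.1.trans h.2.2.symm),
    (𝓖.source_mul _ _ _).trans h.2.1, (𝓖.target_mul _ _ _).trans g.2.2⟩
  one := ⟨𝓖.one x, 𝓖.source_one x, 𝓖.target_one x⟩
  inv g := ⟨𝓖.inv g.1, (𝓖.source_inv _).trans g.2.2, (𝓖.target_inv _).trans g.2.1⟩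
  mul_assoc g h k := Subtype.ext (𝓖.mul_assoc g.1 h.1 k.1 _ _)
  one_mul := by
    rintro ⟨g, hs, rfl⟩
    exact Subtype.ext (𝓖.one_mul g)
  mul_one := by
    rintro ⟨g, rfl, ht⟩
    exact Subtype.ext (𝓖.mul_one g)
  inv_mul_cancel := by
    rintro ⟨g, rfl, ht⟩
    exact Subtype.ext (𝓖.inv_mul g)

/-- Topological groupoids with Hausdorff base. -/
structure IsTopologicalGroupoid [TopologicalSpace G] [TopologicalSpace B] : Prop where
  t2_base : T2Space B
  source_surjective : Function.Surjective 𝓖.source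
  source_continuous : Continuous 𝓖.source
  source_open : IsOpenMap 𝓖.source
  target_surjective : Function.Surjective 𝓖.target
  target_continuous : Continuous 𝓖.target
  target_open : IsOpenMap 𝓖.target
  mul_continuous : Continuous 𝓖.mulMap
  one_embedding : Topology.IsEmbedding 𝓖.one
  inv_homeomorph : IsHomeomorph 𝓖.inv

/-- Real analytic Banach-Lie groupoids: topological groupoids with real analytic (Hausdorff)
Banach manifolds `MG` of arrows and `MB` of objects, such that the source map is a submersion and
all structure maps are real analytic. The domain of the multiplication is a submanifold of the
product manifold. -/
structure IsAnalyticBanachLieGroupoid [TopologicalSpace G] [TopologicalSpace B]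
    (MG : AnalyticBanachManifold.{u} G) (MB : AnalyticBanachManifold.{u} B) : Prop where
  topological : 𝓖.IsTopologicalGroupoid
  t2_arrows : T2Space G
  source_submersion : MG.IsSubmersion MB 𝓖.source
  target_analytic : MG.IsAnalyticMap MB 𝓖.target
  one_analytic : MB.IsAnalyticMap MG 𝓖.one
  inv_analytic : MG.IsAnalyticMap MG 𝓖.inv
  mul_analytic : ∃ M2 : AnalyticBanachManifold.{u} 𝓖.composable,
    M2.IsSubmanifold (MG.prod MG) ∧ M2.IsAnalyticMap MG 𝓖.mulMap

/-- A groupoid is locally transitive if all its orbits are open. -/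
def IsLocallyTransitive [TopologicalSpace B] : Prop := ∀ x, IsOpen (𝓖.orbit x)

end ArrowGroupoid

/-! ### The groupoid of a semigroup -/

/-- The set `Q(A)` of idempotents. -/
def idempotents (A : Type u) [Mul A] : Set A := {p | p * p = p}

/-- The set `𝒢(A)` of pairs of elements that are generalized inverses of each other. -/
def inversePairs (A : Type u) [Mul A] : Set (A × A) :=
  {g | g.1 * g.2 * g.1 = g.1 ∧ g.2 * g.1 * g.2 = g.2}

/-- The groupoid `𝒢(A) ⇉ Q(A)`. -/
def inversePairsGroupoid (A : Type u) [Semigroup A] :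
    ArrowGroupoid (inversePairs A) (idempotents A) where
  source g := ⟨g.1.2 * g.1.1, by
    show g.1.2 * g.1.1 * (g.1.2 * g.1.1) = g.1.2 * g.1.1
    rw [← mul_assoc, g.2.2]⟩
  target g := ⟨g.1.1 * g.1.2, by
    show g.1.1 * g.1.2 * (g.1.1 * g.1.2) = g.1.1 * g.1.2
    rw [← mul_assoc, g.2.1]⟩
  mul g h e := ⟨(g.1.1 * h.1.1, h.1.2 * g.1.2), by
    obtain ⟨⟨a, b⟩, h1, h2⟩ := g
    obtain ⟨⟨c, d⟩, h3, h4⟩ := h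
    have e : b * a = c * d := congrArg Subtype.val e
    dsimp only at h1 h2 h3 h4
    constructor
    · show a * c * (d * b) * (a * c) = a * c
      calc a * c * (d * b) * (a * c) = a * (c * d) * (b * a) * c := by simp only [mul_assoc]
        _ = a * b * a * (c * d * c) := by rw [e, ← e]; simp only [mul_assoc]
        _ = a * c := by rw [h1, h3]
    · show d * b * (a * c) * (d * b) = d * b
      calc d * b * (a * c) * (d * b) = d * (b * a) * (c * d) * b := by simp only [mul_assoc]
        _ = d * c * d * (b * a * b) := by rw [e, ← e, e]; simp only [mul_assoc]
        _ = d * b := by rw [h4, h2]⟩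
  one p := ⟨(p.1, p.1), by
    have hp : p.1 * p.1 = p.1 := p.2
    constructor <;> simp only [hp]⟩
  inv g := ⟨(g.1.2, g.1.1), g.2.2, g.2.1⟩
  source_mul := by
    rintro ⟨⟨a, b⟩, h1, h2⟩ ⟨⟨c, d⟩, h3, h4⟩ e
    have e : b * a = c * d := congrArg Subtype.val e
    dsimp only at h1 h2 h3 h4
    apply Subtype.ext
    show d * b * (a * c) = d * c
    calc d * b * (a * c) = d * (b * a) * c := by simp only [mul_assoc]
      _ = d * c * d * c := by rw [e]; simp only [mul_assoc]
      _ = d * c := by rw [h4]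
  target_mul := by
    rintro ⟨⟨a, b⟩, h1, h2⟩ ⟨⟨c, d⟩, h3, h4⟩ e
    have e : b * a = c * d := congrArg Subtype.val e
    dsimp only at h1 h2 h3 h4
    apply Subtype.ext
    show a * c * (d * b) = a * b
    calc a * c * (d * b) = a * (c * d) * b := by simp only [mul_assoc]
      _ = a * b * a * b := by rw [← e]; simp only [mul_assoc]
      _ = a * b := by rw [h1]
  mul_assoc g h k e e' :=
    Subtype.ext (Prod.ext (mul_assoc _ _ _) (mul_assoc _ _ _).symm)
  source_one p := Subtype.ext p.2
  target_one p := Subtype.ext p.2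
  mul_one := by
    rintro ⟨⟨a, b⟩, h1, h2⟩
    exact Subtype.ext (Prod.ext ((mul_assoc a b a).symm.trans h1) h2)
  one_mul := by
    rintro ⟨⟨a, b⟩, h1, h2⟩
    exact Subtype.ext (Prod.ext h1 ((mul_assoc b a b).symm.trans h2))
  source_inv _ := rfl
  target_inv _ := rfl
  mul_inv _ := rfl
  inv_mul _ := rfl

/-- The unit element as an object of the groupoid. -/
def oneIdempotent (A : Type u) [Monoid A] : idempotents A := ⟨1, mul_one 1⟩

end

/-! All the spaces involved lie in Banach spaces: `Q(A)` in `A`, `𝒢(A)` and the isotropy group in `A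
× A`, the composable pairs in `(A × A) × (A × A)`. Each is locally the image of an analytic
retraction `ρ` of the ambient space. By Cartan's linearization argument (`exists_isAdapted_chart`),
an analytic change of coordinates turns `ρ` into its derivative `P`, a continuous projection, so the
space is modelled on the fixed space of `P`. Taking all charts that extend analytically in both
directions gives the atlas.

With such atlases, a map is analytic once it is locally the restriction of an analytic ambient map,
and the structure maps are restrictions of polynomials. No tangent space is computed: a local
retraction gives the inclusion's tangent map a continuous left inverse, and a local section gives
the source's tangent map a right inverse. Injectivity or surjectivity and the complements follow.

The retractions and sections rest on `u = q p + (1 - q)(1 - p)`, which is `1` at `q = p`, hence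
invertible for `q` near `p`, and satisfies `q u = q p = u p` for idempotents, so `u p u⁻¹ = q`. It
retracts `A` locally onto `Q(A)`. It also moves the source of an arrow `(a, b)` to a nearby
idempotent with the target fixed, via `(a u⁻¹, u b)`; this one section gives the submersion, the
openness of the source map and the openness of orbits. -/

open Filter Topology

/-! ### Germs of analytic maps between embedded spaces, and adapted charts. -/

/-- Near `x`, the map `f` is the restriction of an analytic map between the Banach spaces `E` and
`F` in which its domain and codomain lie through `ι` and `κ`. -/
def AnalyticGermAt {X Y E F : Type*} [TopologicalSpace X]
    [NormedAddCommGroup E] [NormedSpace ℝ E] [NormedAddCommGroup F] [NormedSpace ℝ F]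
    (ι : X → E) (κ : Y → F) (f : X → Y) (x : X) : Prop :=
  ∃ g : E → F, AnalyticAt ℝ g (ι x) ∧ ∀ᶠ y in 𝓝 x, κ (f y) = g (ι y)

namespace AnalyticGermAt

variable {X Y Z E F H : Type*} [TopologicalSpace X]
  [NormedAddCommGroup E] [NormedSpace ℝ E] [NormedAddCommGroup F] [NormedSpace ℝ F]
  [NormedAddCommGroup H] [NormedSpace ℝ H]
  {ι : X → E} {κ : Y → F} {μ : Z → H} {f : X → Y} {h : Y → Z} {x : X}

theorem continuousAt [TopologicalSpace Y] (hf : AnalyticGermAt ι κ f x) (hι : Continuous ι)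
    (hκ : IsEmbedding κ) :
    ContinuousAt f x := by
  obtain ⟨g, hg, hfg⟩ := hf
  rw [hκ.isInducing.continuousAt_iff]
  exact (hg.continuousAt.comp hι.continuousAt).congr (hfg.mono fun _ h => h.symm)

theorem comp [TopologicalSpace Y] (hh : AnalyticGermAt κ μ h (f x)) (hf : AnalyticGermAt ι κ f x)
    (hc : ContinuousAt f x) : AnalyticGermAt ι μ (h ∘ f) x := by
  obtain ⟨g, hg, hfg⟩ := hf
  obtain ⟨k, hk, hhk⟩ := hh
  refine ⟨k ∘ g, AnalyticAt.comp (hfg.self_of_nhds ▸ hk) hg, ?_⟩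
  filter_upwards [hfg, hc.eventually hhk] with y h1 h2
  simp only [Function.comp_apply, h2, h1]

theorem of_forall {g : E → F} (hg : AnalyticAt ℝ g (ι x)) (h : ∀ y, κ (f y) = g (ι y)) :
    AnalyticGermAt ι κ f x :=
  ⟨g, hg, Eventually.of_forall h⟩

theorem analyticAt {f : E → F} {x : E} (hf : AnalyticGermAt id id f x) : AnalyticAt ℝ f x := by
  obtain ⟨g, hg, hfg⟩ := hf
  exact hg.congr (hfg.mono fun _ h => h.symm)

end AnalyticGermAt

/-- A chart which, together with its inverse, is locally the restriction of analytic maps on the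
ambient Banach space `E`. -/
structure BanachChart.IsAdapted {X : Type v} [TopologicalSpace X] {E : Type*}
    [NormedAddCommGroup E] [NormedSpace ℝ E] (c : BanachChart.{u} X) (ι : X → E) : Prop where
  germ : ∀ x ∈ c.hom.source, AnalyticGermAt ι id c.hom x
  germ_symm : ∀ z ∈ c.hom.target, AnalyticGermAt id ι c.hom.symm z

namespace BanachChart.IsAdapted

variable {X : Type v} {Y : Type w} [TopologicalSpace X] [TopologicalSpace Y] {E F : Type*}
  [NormedAddCommGroup E] [NormedSpace ℝ E] [NormedAddCommGroup F] [NormedSpace ℝ F]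
  {ι : X → E} {κ : Y → F} {c : BanachChart.{u} X} {d : BanachChart.{u} Y}

/-- The inverse chart, `f` and the chart compose as germs. Both ends are model spaces embedded by
`id`, where an analytic germ is plain analyticity. -/
theorem analyticAt_comp (hc : c.IsAdapted ι) (hd : d.IsAdapted κ) {f : X → Y} {z : c.E}
    (hz : z ∈ c.hom.target) (hfz : f (c.hom.symm z) ∈ d.hom.source)
    (hf : AnalyticGermAt ι κ f (c.hom.symm z)) (hfc : ContinuousAt f (c.hom.symm z)) :
    AnalyticAt ℝ (d.hom ∘ f ∘ c.hom.symm) z := by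
  have hcs := c.hom.continuousAt_symm hz
  exact ((hd.germ _ hfz).comp (f := f ∘ c.hom.symm) (hf.comp (hc.germ_symm z hz) hcs)
    (hfc.comp hcs)).analyticAt

theorem prod (hc : c.IsAdapted ι) (hd : d.IsAdapted κ) : (c.prod d).IsAdapted (Prod.map ι κ) where
  germ := by
    rintro ⟨x, y⟩ ⟨hx, hy⟩
    obtain ⟨g, hg, hcg⟩ := hc.germ x hx
    obtain ⟨k, hk, hdk⟩ := hd.germ y hy
    refine ⟨Prod.map g k, ?_, ?_⟩
    · exact (AnalyticAt.fun_comp (f := fun p : E × F => p.1) (x := (ι x, κ y)) hg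
        analyticAt_fst).prod (AnalyticAt.fun_comp (f := fun p : E × F => p.2) (x := (ι x, κ y)) hk
        analyticAt_snd)
    · rw [nhds_prod_eq]
      filter_upwards [hcg.prod_mk hdk] with p hp
      exact Prod.ext hp.1 hp.2
  germ_symm := by
    rintro ⟨x, y⟩ ⟨hx, hy⟩
    obtain ⟨g, hg, hcg⟩ := hc.germ_symm x hx
    obtain ⟨k, hk, hdk⟩ := hd.germ_symm y hy
    refine ⟨Prod.map g k, ?_, ?_⟩
    · exact (AnalyticAt.fun_comp (f := fun p : c.E × d.E => p.1) (x := (x, y)) hg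
        analyticAt_fst).prod (AnalyticAt.fun_comp (f := fun p : c.E × d.E => p.2) (x := (x, y)) hk
        analyticAt_snd)
    · have h := hcg.prod_mk hdk
      rw [← nhds_prod_eq] at h
      exact h.mono fun p hp => Prod.ext hp.1 hp.2

/-- The chain rule for `s ∘ f = id` near `x`, read in charts. Both base point conditions are
equations, so that the lemma serves left inverses (`y` is `f x` by definition) as well as sections,
with the roles of the maps exchanged. -/
theorem tangentIn_comp_tangentIn (hc : c.IsAdapted ι) (hd : d.IsAdapted κ) (hι : IsEmbedding ι)
    (hκ : IsEmbedding κ) {f : X → Y} {s : Y → X} {x : X} {y : Y} (hxy : f x = y) (hyx : s y = x)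
    (hx : x ∈ c.hom.source) (hy : y ∈ d.hom.source) (hf : AnalyticGermAt ι κ f x)
    (hs : AnalyticGermAt κ ι s y) (hsf : ∀ᶠ x' in 𝓝 x, s (f x') = x') :
    (AnalyticBanachManifold.tangentIn d c s y).comp (AnalyticBanachManifold.tangentIn c d f x) =
      ContinuousLinearMap.id ℝ c.E := by
  have hfc := hf.continuousAt hι.continuous hκ
  have hsc := hs.continuousAt hκ.continuous hι
  have ex := c.hom.left_inv hx
  have ey := d.hom.left_inv hy
  have hF : AnalyticAt ℝ (d.hom ∘ f ∘ c.hom.symm) (c.hom x) :=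
    hc.analyticAt_comp hd (c.hom.map_source hx) (by rwa [ex, hxy]) (by rwa [ex]) (by rwa [ex])
  have hS : AnalyticAt ℝ (c.hom ∘ s ∘ d.hom.symm) (d.hom y) :=
    hd.analyticAt_comp hc (d.hom.map_source hy) (by rwa [ey, hyx]) (by rwa [ey]) (by rwa [ey])
  have e1 : (d.hom ∘ f ∘ c.hom.symm) (c.hom x) = d.hom y := by
    simp only [Function.comp_apply, ex, hxy]
  have hcomp := fderiv_comp (𝕜 := ℝ) (c.hom x) (g := c.hom ∘ s ∘ d.hom.symm)
    (f := d.hom ∘ f ∘ c.hom.symm) (by rw [e1]; exact hS.differentiableAt) hF.differentiableAt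
  rw [e1] at hcomp
  rw [AnalyticBanachManifold.tangentIn, AnalyticBanachManifold.tangentIn, ← hcomp,
    ← fderiv_id (𝕜 := ℝ) (x := c.hom x)]
  apply Filter.EventuallyEq.fderiv_eq
  have hct : Tendsto c.hom.symm (𝓝 (c.hom x)) (𝓝 x) := by
    simpa only [ex, ContinuousAt] using c.hom.continuousAt_symm (c.hom.map_source hx)
  have hft : Tendsto f (𝓝 x) (𝓝 y) := hxy ▸ hfc
  filter_upwards [hct.eventually hsf,
    hct.eventually (hft.eventually (d.hom.open_source.mem_nhds hy)),
    c.hom.open_target.mem_nhds (c.hom.map_source hx)] with z h1 h2 h3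
  simp only [Function.comp_apply, d.hom.left_inv h2, h1, c.hom.right_inv h3, id]

end BanachChart.IsAdapted

/-! ### Immersions, submersions and submanifolds through local one-sided inverses. -/

namespace AnalyticBanachManifold

/-- All charts of the manifold `M` are adapted to the embedding `ι` into a Banach space. -/
structure IsAdapted {X : Type v} [TopologicalSpace X] {E : Type*} [NormedAddCommGroup E]
    [NormedSpace ℝ E] (M : AnalyticBanachManifold.{u} X) (ι : X → E) : Prop where
  isEmbedding : IsEmbedding ι
  charts : ∀ c ∈ M.charts, c.IsAdapted ι

variable {X : Type v} {Y : Type w} [TopologicalSpace X] [TopologicalSpace Y] {E F : Type*}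
  [NormedAddCommGroup E] [NormedSpace ℝ E] [NormedAddCommGroup F] [NormedSpace ℝ F]
  {ι : X → E} {κ : Y → F} {M : AnalyticBanachManifold.{u} X} {N : AnalyticBanachManifold.{u} Y}

theorem IsAdapted.prod (hM : M.IsAdapted ι) (hN : N.IsAdapted κ) :
    (M.prod N).IsAdapted (Prod.map ι κ) where
  isEmbedding := hM.isEmbedding.prodMap hN.isEmbedding
  charts := by
    rintro _ ⟨c, hc, d, hd, rfl⟩
    exact (hM.charts c hc).prod (hN.charts d hd)

theorem isAdapted_ofOpenEmbedding [Nonempty X] {E : Type u} [NormedAddCommGroup E]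
    [NormedSpace ℝ E] [CompleteSpace E] {φ : X → E} (hφ : IsOpenEmbedding φ) :
    (ofOpenEmbedding φ hφ).IsAdapted φ where
  isEmbedding := hφ.isEmbedding
  charts := by
    rintro _ rfl
    refine ⟨fun x _ => .of_forall analyticAt_id fun _ => rfl, fun z hz => ⟨id, analyticAt_id, ?_⟩⟩
    filter_upwards [(hφ.toOpenPartialHomeomorph φ).open_target.mem_nhds hz] with y hy
    exact (hφ.toOpenPartialHomeomorph φ).right_inv hy

theorem isAdapted_ofBanachSpace (E : Type u) [NormedAddCommGroup E] [NormedSpace ℝ E]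
    [CompleteSpace E] : (ofBanachSpace E).IsAdapted (id : E → E) where
  isEmbedding := .id
  charts := by
    rintro _ rfl
    exact ⟨fun x _ => .of_forall analyticAt_id fun _ => rfl,
      fun x _ => .of_forall analyticAt_id fun _ => rfl⟩

theorem isAdapted_ofUnits (A : Type u) [NormedRing A] [NormedAlgebra ℝ A] [CompleteSpace A] :
    (ofUnits A).IsAdapted (Units.val : Aˣ → A) :=
  isAdapted_ofOpenEmbedding _

theorem IsAdapted.isAnalyticMap (hM : M.IsAdapted ι) (hN : N.IsAdapted κ) {f : X → Y}
    (hf : ∀ x, AnalyticGermAt ι κ f x) : IsAnalyticMap M N f := by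
  have hfc : Continuous f := continuous_iff_continuousAt.2 fun x =>
    (hf x).continuousAt hM.isEmbedding.continuous hN.isEmbedding
  exact ⟨hfc, fun c hc d hd z hz => (hM.charts c hc).analyticAt_comp (hN.charts d hd) hz.1 hz.2
    (hf _) hfc.continuousAt⟩

/-- The tangent map of the local left inverse `s` is a continuous left inverse of that of `f`, which
yields injectivity and a complement of the range together. -/
theorem IsAdapted.isSplitImmersion (hM : M.IsAdapted ι) (hN : N.IsAdapted κ) {f : X → Y}
    (hf : ∀ x, AnalyticGermAt ι κ f x)
    (h : ∀ x, ∃ s : Y → X, AnalyticGermAt κ ι s (f x) ∧ ∀ᶠ x' in 𝓝 x, s (f x') = x') :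
    IsSplitImmersion M N f := by
  refine ⟨hM.isAnalyticMap hN hf, fun x c hc d hd hx hy => ?_⟩
  obtain ⟨s, hs, hsf⟩ := h x
  have key := (hM.charts c hc).tangentIn_comp_tangentIn (hN.charts d hd) hM.isEmbedding
    hN.isEmbedding rfl hsf.self_of_nhds hx hy (hf x) hs hsf
  have hl : Function.LeftInverse (tangentIn d c s (f x)) (tangentIn c d f x) :=
    fun v => DFunLike.congr_fun key v
  exact ⟨hl.injective, ContinuousLinearMap.HasLeftInverse.closedComplemented_range ⟨_, hl⟩⟩

/-- Dually, a local section through `x` makes the tangent map right invertible, so it is onto and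
its kernel splits. -/
theorem IsAdapted.isSubmersion (hM : M.IsAdapted ι) (hN : N.IsAdapted κ) {f : X → Y}
    (hsurj : Function.Surjective f) (hf : ∀ x, AnalyticGermAt ι κ f x)
    (h : ∀ x, ∃ s : Y → X, AnalyticGermAt κ ι s (f x) ∧ s (f x) = x ∧
      ∀ᶠ y in 𝓝 (f x), f (s y) = y) :
    IsSubmersion M N f := by
  refine ⟨hsurj, hM.isAnalyticMap hN hf, fun x c hc d hd hx hy => ?_⟩
  obtain ⟨s, hs, hsx, hfs⟩ := h x
  have key := (hN.charts d hd).tangentIn_comp_tangentIn (hM.charts c hc) hN.isEmbedding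
    hM.isEmbedding hsx rfl hy hx hs (hf x) hfs
  have hr : Function.RightInverse (tangentIn d c s (f x)) (tangentIn c d f x) :=
    fun v => DFunLike.congr_fun key v
  exact ⟨hr.surjective, (tangentIn c d f x).closedComplemented_ker_of_rightInverse _ hr⟩

/-- A subset of `Y` is a submanifold if it is a local retract of the Banach space in which `Y`
lies. -/
theorem IsAdapted.isSubmanifold {S : Set Y} {M : AnalyticBanachManifold.{u} S} {ι : S → F}
    (hM : M.IsAdapted ι) (hN : N.IsAdapted κ) (hS : IsClosed S) (hι : ∀ x : S, ι x = κ x)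
    (hr : ∀ x : S, ∃ r : F → S, AnalyticGermAt id ι r (ι x) ∧ ∀ᶠ y in 𝓝 x, r (ι y) = y) :
    M.IsSubmanifold N := by
  refine ⟨hS, hM.isSplitImmersion hN
    (fun x => .of_forall analyticAt_id fun y => (hι y).symm) fun x => ?_⟩
  obtain ⟨r, ⟨g, hg, hrg⟩, hrι⟩ := hr x
  -- The ambient retraction, restricted to `Y`, is the local left inverse of the inclusion.
  refine ⟨r ∘ κ, ⟨g, hι x ▸ hg, ?_⟩, hrι.mono fun y hy => by rw [Function.comp_apply, ← hι, hy]⟩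
  exact hN.isEmbedding.continuous.continuousAt.eventually (hι x ▸ hrg)

end AnalyticBanachManifold

/-- Two maps that are inverse only near the base points are cut down to `U ∩ f⁻¹ V` and `V ∩ g⁻¹ U`.
The predicate `p` carries one more local property to the whole target; it will be the analyticity of
the inverse chart. -/
theorem exists_openPartialHomeomorph_of_eventually {X Y : Type*} [TopologicalSpace X]
    [TopologicalSpace Y] {f : X → Y} {g : Y → X} {x : X} (p : Y → Prop)
    (hf : ∀ᶠ x' in 𝓝 x, ContinuousAt f x') (hg : ∀ᶠ y in 𝓝 (f x), ContinuousAt g y)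
    (hgf : ∀ᶠ x' in 𝓝 x, g (f x') = x') (hfg : ∀ᶠ y in 𝓝 (f x), f (g y) = y)
    (hp : ∀ᶠ y in 𝓝 (f x), p y) :
    ∃ e : OpenPartialHomeomorph X Y, (e : X → Y) = f ∧ (e.symm : Y → X) = g ∧ x ∈ e.source ∧
      ∀ y ∈ e.target, p y := by
  obtain ⟨U, hU, hUo, hxU⟩ := eventually_nhds_iff.1 (hf.and hgf)
  obtain ⟨V, hV, hVo, hyV⟩ := eventually_nhds_iff.1 (hg.and (hfg.and hp))
  have hfU : ContinuousOn f U := fun z hz => (hU z hz).1.continuousWithinAt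
  have hgV : ContinuousOn g V := fun z hz => (hV z hz).1.continuousWithinAt
  refine ⟨{
    toFun := f
    invFun := g
    source := U ∩ f ⁻¹' V
    target := V ∩ g ⁻¹' U
    map_source' := fun z hz => ⟨hz.2, by rw [Set.mem_preimage, (hU z hz.1).2]; exact hz.1⟩
    map_target' := fun z hz => ⟨hz.2, by rw [Set.mem_preimage, (hV z hz.1).2.1]; exact hz.1⟩
    left_inv' := fun z hz => (hU z hz.1).2
    right_inv' := fun z hz => (hV z hz.1).2.1
    open_source := hfU.isOpen_inter_preimage hUo hVo
    open_target := hgV.isOpen_inter_preimage hVo hUo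
    continuousOn_toFun := hfU.mono Set.inter_subset_left
    continuousOn_invFun := hgV.mono Set.inter_subset_left }, rfl, rfl, ⟨hxU, hyV⟩,
    fun y hy => (hV y hy.1).2.2⟩

/-! ### Cartan's theorem: local analytic retracts are manifolds. -/

section LocalRetraction

variable {X : Type v} [TopologicalSpace X] {E : Type u} [NormedAddCommGroup E] [NormedSpace ℝ E]

/-- The topological space `X`, mapped to a Banach space by `ι`, is locally an analytic retract. -/
def HasLocalRetractions (ι : X → E) : Prop :=
  ∀ x, ∃ r : E → X, AnalyticGermAt id ι r (ι x) ∧ ∀ᶠ y in 𝓝 x, r (ι y) = y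

/-- An analytic map which takes values in the range of `ι` near `ι x` and fixes its points
gives a local retraction. -/
theorem exists_retraction_of_eventually {ι : X → E} (hι : IsEmbedding ι) {x : X} {ρ : E → E}
    (hρ : AnalyticAt ℝ ρ (ι x)) (hmem : ∀ᶠ e in 𝓝 (ι x), ρ e ∈ Set.range ι)
    (hfix : ∀ᶠ y in 𝓝 x, ρ (ι y) = ι y) :
    ∃ r : E → X, AnalyticGermAt id ι r (ι x) ∧ ∀ᶠ y in 𝓝 x, r (ι y) = y := by
  classical
  -- Choice picks a preimage of `ρ e`, unique as `ι` is injective. The default `x` is never used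
  -- near `ι x`.
  have key : ∀ e, ρ e ∈ Set.range ι →
      ι (if h : ρ e ∈ Set.range ι then h.choose else x) = ρ e := fun e h => by
    rw [dif_pos h, h.choose_spec]
  refine ⟨fun e => if h : ρ e ∈ Set.range ι then h.choose else x, ⟨ρ, hρ, hmem.mono key⟩, ?_⟩
  filter_upwards [hfix] with y hy
  exact hι.injective ((key (ι y) ⟨y, hy.symm⟩).trans hy)

variable [CompleteSpace E]

/-- A map with local analytic retractions to `X` admits a chart of `X` around each point. -/
theorem exists_isAdapted_chart {ι : X → E} (hι : IsEmbedding ι) {x : X} {r : E → X}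
    (hr : AnalyticGermAt id ι r (ι x)) (hrι : ∀ᶠ y in 𝓝 x, r (ι y) = y) :
    ∃ c : BanachChart.{u} X, c.IsAdapted ι ∧ x ∈ c.hom.source := by
  set e₀ := ι x with he₀
  have hrc : ContinuousAt r e₀ := hr.continuousAt continuous_id hι
  have hrx : r e₀ = x := hrι.self_of_nhds
  obtain ⟨ρ, hρ, hρr⟩ : ∃ ρ : E → E, AnalyticAt ℝ ρ e₀ ∧ ∀ᶠ e in 𝓝 e₀, ι (r e) = ρ e := hr
  have hρ₀ : ρ e₀ = e₀ := by rw [← hρr.self_of_nhds, hrx]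
  have hρι : ∀ᶠ y in 𝓝 x, ρ (ι y) = ι y := by
    filter_upwards [hrι, hι.continuous.continuousAt.eventually hρr] with y h1 h2
    rw [← h2, h1]
  have hρρ : ∀ᶠ e in 𝓝 e₀, ρ (ρ e) = ρ e := by
    have h : Tendsto r (𝓝 e₀) (𝓝 x) := by simpa only [ContinuousAt, hrx] using hrc
    filter_upwards [hρr, h.eventually hρι] with e h1 h2
    rw [← h1, h2]
  set P := fderiv ℝ ρ e₀ with hP
  -- Differentiating `ρ ∘ ρ = ρ` at its fixed point `e₀` shows that `P` is a projection.
  have hPP : ∀ v, P (P v) = P v := by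
    have h : fderiv ℝ (ρ ∘ ρ) e₀ = P.comp P := by
      rw [fderiv_comp e₀ (by rw [hρ₀]; exact hρ.differentiableAt) hρ.differentiableAt, hρ₀]
    intro v
    have h' : fderiv ℝ (ρ ∘ ρ) e₀ = P := Filter.EventuallyEq.fderiv_eq hρρ
    exact (DFunLike.congr_fun (h.symm.trans h') v :)
  -- The linearizing coordinate: its derivative at `e₀` is `P P + (1 - P)(1 - P) = 1`, and `P (Φ e)
  -- = P (ρ e - e₀)`. Hence it is a local analytic isomorphism near `e₀` carrying `ρ` to `P`.
  let Φ : E → E := fun e => P (ρ e - e₀) + ((e - ρ e) - P (e - ρ e))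
  have hΦ : AnalyticAt ℝ Φ e₀ := by
    have hPa : ∀ {h : E → E}, AnalyticAt ℝ h e₀ → AnalyticAt ℝ (fun e => P (h e)) e₀ :=
      fun hh => (P.analyticAt _).comp hh
    exact (hPa (hρ.sub analyticAt_const)).add
      ((analyticAt_id.sub hρ).sub (hPa (analyticAt_id.sub hρ)))
  have hΦ' : fderiv ℝ Φ e₀ = (ContinuousLinearEquiv.refl ℝ E : E →L[ℝ] E) := by
    have h1 : HasFDerivAt ρ P e₀ := hρ.differentiableAt.hasFDerivAt
    have h2 := (hasFDerivAt_id e₀).sub h1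
    have h3 := (P.hasFDerivAt.comp e₀ (h1.sub_const e₀)).add (h2.sub (P.hasFDerivAt.comp e₀ h2))
    refine (HasFDerivAt.fderiv h3).trans ?_
    ext v
    simp [hPP]
  have hΦs : HasStrictFDerivAt Φ ((ContinuousLinearEquiv.refl ℝ E : E ≃L[ℝ] E) : E →L[ℝ] E) e₀ :=
    hΦ' ▸ hΦ.hasStrictFDerivAt
  set T := hΦs.toOpenPartialHomeomorph Φ with hT
  have hTs : e₀ ∈ T.source := hΦs.mem_toOpenPartialHomeomorph_source
  have hΦ₀ : Φ e₀ = 0 := by simp [Φ, hρ₀]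
  have hTe₀ : T e₀ = 0 := hΦ₀
  have hT0 : (0 : E) ∈ T.target := hTe₀ ▸ T.map_source hTs
  have hTsymm0 : T.symm 0 = e₀ := by rw [← hTe₀, T.left_inv hTs]
  have hTan : AnalyticAt ℝ T.symm 0 := by
    have := T.analyticAt_symm' hTs hΦ hΦ'
    rwa [hTe₀] at this
  -- The range of the projection `P`, written as the kernel of `P - 1` so that it is visibly closed,
  -- hence complete.
  let F : Submodule ℝ E := LinearMap.ker (P - ContinuousLinearMap.id ℝ E).toLinearMap
  have hF : ∀ v, v ∈ F ↔ P v = v := fun v => by simp [F, sub_eq_zero]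
  have hFc : IsClosed (F : Set E) := (P - ContinuousLinearMap.id ℝ E).isClosed_ker
  have : CompleteSpace F := hFc.completeSpace_coe
  let PF : E →L[ℝ] F := P.codRestrict F fun v => (hF _).2 (hPP v)
  let f : X → F := fun y => PF (ι y - e₀)
  let g : F → X := fun z => r (T.symm z)
  have hf0 : f x = 0 := by simp [f, he₀]
  have hgGerm : AnalyticGermAt id ι g (0 : F) := by
    have h0 : AnalyticAt ℝ (fun z : F => T.symm z) 0 :=
      AnalyticAt.fun_comp (f := fun z : F => (z : E)) (x := (0 : F)) (by simpa using hTan)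
        (F.subtypeL.analyticAt 0)
    refine ⟨fun z => ρ (T.symm z), AnalyticAt.fun_comp (by simpa [hTsymm0] using hρ) h0, ?_⟩
    have h1 : Tendsto (fun z : F => T.symm z) (𝓝 0) (𝓝 e₀) := by
      simpa [hTsymm0] using h0.continuousAt.tendsto
    exact h1.eventually hρr
  -- An adapted chart needs the germ at every point of its target; analyticity at a point spreads to
  -- a neighbourhood.
  have hgGerm' : ∀ᶠ z in 𝓝 (f x), AnalyticGermAt id ι g z := by
    rw [hf0]
    obtain ⟨k, hk, hgk⟩ := hgGerm
    filter_upwards [hk.eventually_analyticAt, hgk.eventually_nhds] with z h1 h2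
    exact ⟨k, h1, h2⟩
  have hgf : ∀ᶠ y in 𝓝 x, g (f y) = y := by
    filter_upwards [hρι, hrι, hι.continuous.continuousAt.eventually (T.open_source.mem_nhds hTs)]
      with y h1 h2 h3
    -- Where `ρ` fixes `ι y`, the second summand of `Φ` vanishes.
    have h4 : T (ι y) = f y := by
      show P (ρ (ι y) - e₀) + ((ι y - ρ (ι y)) - P (ι y - ρ (ι y))) = P (ι y - e₀)
      simp [h1]
    show r (T.symm (f y)) = y
    rw [← h4, T.left_inv h3, h2]
  have hfg : ∀ᶠ z in 𝓝 (f x), f (g z) = z := by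
    rw [hf0]
    have hz : Tendsto (fun z : F => (z : E)) (𝓝 0) (𝓝 0) := by
      simpa using (continuous_subtype_val (p := (· ∈ F))).tendsto 0
    have hz' : Tendsto (fun z : F => T.symm z) (𝓝 0) (𝓝 e₀) := by
      simpa [hTsymm0, Function.comp_def] using hTan.continuousAt.tendsto.comp hz
    filter_upwards [hz.eventually (T.open_target.mem_nhds hT0), hz'.eventually hρr] with z h1 h2
    have h3 : Φ (T.symm z) = z := T.right_inv h1
    apply Subtype.ext
    show P (ι (r (T.symm z)) - e₀) = z
    -- Apply `P` to `Φ (T.symm z) = z`: the complementary summand dies, and `P z = z` on `F`.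
    refine Eq.trans ?_ ((congrArg P h3).trans ((hF z).1 z.2))
    rw [h2]
    simp [Φ, hPP]
  obtain ⟨e, hef, heg, hxe, hep⟩ := exists_openPartialHomeomorph_of_eventually
    (fun z => AnalyticGermAt id ι g z) (f := f) (g := g) (x := x)
    (Eventually.of_forall fun y =>
      (PF.continuous.comp (hι.continuous.sub continuous_const)).continuousAt)
    (hgGerm'.mono fun z hz => hz.continuousAt continuous_id hι) hgf hfg hgGerm'
  refine ⟨{ E := F, hom := e }, ⟨fun y _ => ?_, fun z hz => ?_⟩, hxe⟩
  · show AnalyticGermAt ι id e y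
    rw [hef]
    exact .of_forall (g := fun v => PF (v - e₀))
      ((PF.analyticAt _).comp (analyticAt_id.sub analyticAt_const)) fun _ => rfl
  · show AnalyticGermAt id ι e.symm z
    rw [heg]
    exact hep z hz

namespace AnalyticBanachManifold

/-- The manifold structure on a local analytic retract of a Banach space, consisting of all charts
adapted to the embedding. -/
noncomputable def ofLocalRetractions (ι : X → E) (hι : IsEmbedding ι)
    (h : HasLocalRetractions ι) : AnalyticBanachManifold.{u} X where
  charts := {c | c.IsAdapted ι}
  cover x := by
    obtain ⟨r, hr, hrι⟩ := h x
    exact exists_isAdapted_chart hι hr hrι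
  compat c hc d hd z hz := hc.analyticAt_comp hd (f := id) hz.1 hz.2
    (.of_forall analyticAt_id fun _ => rfl) continuousAt_id

theorem isAdapted_ofLocalRetractions {ι : X → E} (hι : IsEmbedding ι)
    (h : HasLocalRetractions ι) : (ofLocalRetractions ι hι h).IsAdapted ι :=
  ⟨hι, fun _ hc => hc⟩

end AnalyticBanachManifold

end LocalRetraction

/-! ### Conjugating idempotents, and the algebra of generalized inverses. -/

section Conjugator

variable {A : Type u} [Ring A]

/-- If `p` and `q` are idempotents and this element is invertible, then it conjugates `p` to
`q`. -/
def idempotentConjugator (q p : A) : A := q * p + (1 - q) * (1 - p)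

theorem idempotentConjugator_self {p : A} (hp : p * p = p) : idempotentConjugator p p = 1 := by
  simp only [idempotentConjugator, mul_sub, sub_mul, one_mul, mul_one, hp]
  abel

theorem idempotentConjugator_mul (q : A) {p : A} (hp : p * p = p) :
    idempotentConjugator q p * p = q * p := by
  simp [idempotentConjugator, add_mul, mul_assoc, sub_mul, hp]

theorem mul_idempotentConjugator {q : A} (hq : q * q = q) (p : A) :
    q * idempotentConjugator q p = q * p := by
  simp [idempotentConjugator, mul_add, ← mul_assoc, mul_sub, hq]

/-- With `u` the conjugator, `u p = q p = q u`; cancel `u` on the right. -/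
theorem idempotentConjugator_conj {q p : A} (hq : q * q = q) (hp : p * p = p)
    (hu : IsUnit (idempotentConjugator q p)) :
    idempotentConjugator q p * p * Ring.inverse (idempotentConjugator q p) = q := by
  rw [idempotentConjugator_mul q hp, ← mul_idempotentConjugator hq, mul_assoc,
    Ring.mul_inverse_cancel _ hu, mul_one]

theorem conj_mul_conj {u p : A} (hu : IsUnit u) (hp : p * p = p) :
    u * p * Ring.inverse u * (u * p * Ring.inverse u) = u * p * Ring.inverse u := by
  calc u * p * Ring.inverse u * (u * p * Ring.inverse u)
      = u * p * (Ring.inverse u * u) * (p * Ring.inverse u) := by simp only [mul_assoc]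
    _ = u * (p * p) * Ring.inverse u := by
        rw [Ring.inverse_mul_cancel _ hu]; simp only [mul_assoc, one_mul]
    _ = u * p * Ring.inverse u := by rw [hp]

end Conjugator

theorem idempotents_mul_self {A : Type u} [Mul A] (p : idempotents A) : (p : A) * p = p := p.2

section InversePairs

variable {A : Type u} [Semigroup A] (g : inversePairs A)

@[simp]
theorem inversePairsGroupoid_source_val :
    ((inversePairsGroupoid A).source g : A) = g.1.2 * g.1.1 := rfl

@[simp]
theorem inversePairsGroupoid_target_val :
    ((inversePairsGroupoid A).target g : A) = g.1.1 * g.1.2 := rfl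

theorem inversePairs_mul_mul_fst : g.1.1 * (g.1.2 * g.1.1) = g.1.1 := by
  rw [← mul_assoc, g.2.1]

end InversePairs

section Conj

variable {A : Type u} [Ring A] {g : A × A} {u : A}

/-- The new pair has the same target `a b`, while its source is `b a` conjugated by `u`. -/
theorem mul_inverse_mem_inversePairs (hg : g ∈ inversePairs A) (hu : IsUnit u) :
    (g.1 * Ring.inverse u, u * g.2) ∈ inversePairs A := by
  have h := Ring.inverse_mul_cancel _ hu
  have h1 : g.1 * Ring.inverse u * (u * g.2) = g.1 * g.2 := by
    rw [mul_assoc, ← mul_assoc _ u, h, one_mul]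
  constructor
  · show g.1 * Ring.inverse u * (u * g.2) * (g.1 * Ring.inverse u) = _
    rw [h1, ← mul_assoc, hg.1]
  · show u * g.2 * (g.1 * Ring.inverse u) * (u * g.2) = _
    rw [mul_assoc, h1, mul_assoc, ← mul_assoc g.2, hg.2]

theorem mul_mem_inversePairs (hg : g ∈ inversePairs A) (hu : IsUnit u) :
    (u * g.1, g.2 * Ring.inverse u) ∈ inversePairs A := by
  have h := mul_inverse_mem_inversePairs (g := g.swap) ⟨hg.2, hg.1⟩ hu
  exact ⟨h.2, h.1⟩

end Conj

/-! ### Analytic local retractions onto idempotents, arrows and composable pairs. -/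

section Analytic

variable {A : Type u} [NormedRing A] [NormedAlgebra ℝ A] [CompleteSpace A]
  {E : Type*} [NormedAddCommGroup E] [NormedSpace ℝ E]

theorem AnalyticAt.ringInverse {f : E → A} {x : E} (hf : AnalyticAt ℝ f x) (hu : IsUnit (f x)) :
    AnalyticAt ℝ (fun y => Ring.inverse (f y)) x := by
  obtain ⟨z, hz⟩ := hu
  exact AnalyticAt.fun_comp (hz ▸ analyticAt_inverse z) hf

omit [NormedAlgebra ℝ A] in
theorem ContinuousAt.eventually_isUnit {X : Type*} [TopologicalSpace X] {f : X → A} {x : X}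
    (hf : ContinuousAt f x) (hu : IsUnit (f x)) : ∀ᶠ y in 𝓝 x, IsUnit (f y) :=
  hf.eventually (Units.isOpen.mem_nhds hu)

omit [CompleteSpace A] in
theorem AnalyticAt.idempotentConjugator {f h : E → A} {x : E} (hf : AnalyticAt ℝ f x)
    (hh : AnalyticAt ℝ h x) : AnalyticAt ℝ (fun y => idempotentConjugator (f y) (h y)) x :=
  (hf.mul hh).add ((analyticAt_const.sub hf).mul (analyticAt_const.sub hh))

/-- The local retraction of `A` to the idempotents around the idempotent `p`. -/
noncomputable def idempotentRetraction (p y : A) : A :=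
  idempotentConjugator y p * p * Ring.inverse (idempotentConjugator y p)

omit [NormedAlgebra ℝ A] [CompleteSpace A] in
theorem idempotentRetraction_of_mem {p : A} (hp : p * p = p) {q : A} (hq : q * q = q)
    (hu : IsUnit (idempotentConjugator q p)) : idempotentRetraction p q = q :=
  idempotentConjugator_conj hq hp hu

theorem analyticAt_idempotentRetraction {p : A} (hp : p * p = p) :
    AnalyticAt ℝ (idempotentRetraction p) p := by
  have h : AnalyticAt ℝ (fun y : A => idempotentConjugator y p) p :=
    analyticAt_id.idempotentConjugator analyticAt_const
  exact (h.mul analyticAt_const).mul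
    (h.ringInverse (by rw [idempotentConjugator_self hp]; exact isUnit_one))

omit [NormedAlgebra ℝ A] in
theorem eventually_isUnit_idempotentConjugator {p : A} (hp : p * p = p) :
    ∀ᶠ y in 𝓝 p, IsUnit (idempotentConjugator y p) :=
  ContinuousAt.eventually_isUnit (by unfold idempotentConjugator; fun_prop)
    (by rw [idempotentConjugator_self hp]; exact isUnit_one)

variable (A)

theorem hasLocalRetractions_idempotents :
    HasLocalRetractions (Subtype.val : idempotents A → A) := by
  intro p
  have hp := idempotents_mul_self p
  have hu := eventually_isUnit_idempotentConjugator hp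
  refine exists_retraction_of_eventually .subtypeVal (analyticAt_idempotentRetraction hp) ?_ ?_
  · filter_upwards [hu] with y hy
    exact ⟨⟨_, conj_mul_conj hy hp⟩, rfl⟩
  · filter_upwards [continuous_subtype_val.continuousAt.eventually hu] with y hy
    exact idempotentRetraction_of_mem hp y.2 hy

/-- For `(a, b)` near `g`, `b a` is near the idempotent `q` and is first retracted to an idempotent
`P`. Then `a` is replaced by `a P`, and `b` by `W⁻¹ P b`, normalized so that the product `b a` of
the new pair is exactly `P`; this makes the two generalized inverses of each other. -/
theorem hasLocalRetractions_inversePairs :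
    HasLocalRetractions (Subtype.val : inversePairs A → A × A) := by
  intro g
  set q : A := g.1.2 * g.1.1 with hq
  have hqq : q * q = q := ((inversePairsGroupoid A).source g).2
  let P : A × A → A := fun e => idempotentRetraction q (e.2 * e.1)
  -- The compression of `b a` to the corner of `P`, completed by `1 - P`: it commutes with `P`, and
  -- equals `1` on arrows near `g`, hence is invertible near `g`.
  let W : A × A → A := fun e => P e * (e.2 * e.1) * P e + (1 - P e)
  have hm : AnalyticAt ℝ (fun e : A × A => e.2 * e.1) g.1 := analyticAt_snd.mul analyticAt_fst
  have hP : AnalyticAt ℝ P g.1 :=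
    AnalyticAt.fun_comp (g := idempotentRetraction q) (analyticAt_idempotentRetraction hqq) hm
  have hW : AnalyticAt ℝ W g.1 :=
    ((hP.mul hm).mul hP).add (analyticAt_const.sub hP)
  have hu : ∀ᶠ e : A × A in 𝓝 g.1, IsUnit (idempotentConjugator (e.2 * e.1) q) :=
    hm.continuousAt.eventually (eventually_isUnit_idempotentConjugator hqq)
  have hPg : ∀ h : inversePairs A, IsUnit (idempotentConjugator (h.1.2 * h.1.1) q) →
      P h.1 = h.1.2 * h.1.1 := fun h hh =>
    idempotentRetraction_of_mem hqq ((inversePairsGroupoid A).source h).2 hh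
  have hWg : ∀ h : inversePairs A, IsUnit (idempotentConjugator (h.1.2 * h.1.1) q) →
      W h.1 = 1 := fun h hh => by
    have h1 : h.1.2 * h.1.1 * (h.1.2 * h.1.1) = h.1.2 * h.1.1 :=
      ((inversePairsGroupoid A).source h).2
    simp only [W, hPg h hh, h1, add_sub_cancel]
  have hWu : IsUnit (W g.1) := by rw [hWg g hu.self_of_nhds]; exact isUnit_one
  refine exists_retraction_of_eventually .subtypeVal
    (ρ := fun e => (e.1 * P e, Ring.inverse (W e) * P e * e.2))
    ((analyticAt_fst.mul hP).prod (((hW.ringInverse hWu).mul hP).mul analyticAt_snd)) ?_ ?_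
  · filter_upwards [hu, hW.continuousAt.eventually_isUnit hWu] with e h1 h2
    have hPP : P e * P e = P e := conj_mul_conj h1 hqq
    have hPW : P e * W e = P e * (e.2 * e.1) * P e := by
      simp only [W, mul_add, mul_sub, mul_one, hPP, sub_self, add_zero, ← mul_assoc]
    have hWP : W e * P e = P e * (e.2 * e.1) * P e := by
      simp only [W, add_mul, sub_mul, one_mul, hPP, sub_self, add_zero, mul_assoc]
    have hinv : Ring.inverse (W e) * P e = P e * Ring.inverse (W e) := by
      calc Ring.inverse (W e) * P e
          = Ring.inverse (W e) * (P e * W e) * Ring.inverse (W e) := by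
            rw [mul_assoc, mul_assoc, Ring.mul_inverse_cancel _ h2, mul_one]
        _ = P e * Ring.inverse (W e) := by
            rw [hPW, ← hWP, ← mul_assoc, Ring.inverse_mul_cancel _ h2, one_mul]
    have key : Ring.inverse (W e) * P e * e.2 * (e.1 * P e) = P e := by
      calc Ring.inverse (W e) * P e * e.2 * (e.1 * P e)
          = Ring.inverse (W e) * (P e * (e.2 * e.1) * P e) := by simp only [mul_assoc]
        _ = P e := by rw [← hWP, ← mul_assoc, Ring.inverse_mul_cancel _ h2, one_mul]
    refine ⟨⟨_, ?_, ?_⟩, rfl⟩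
    · show e.1 * P e * (Ring.inverse (W e) * P e * e.2) * (e.1 * P e) = _
      rw [mul_assoc, key, mul_assoc, hPP]
    · show Ring.inverse (W e) * P e * e.2 * (e.1 * P e) * (Ring.inverse (W e) * P e * e.2) = _
      rw [key, ← mul_assoc, hinv, ← mul_assoc, hPP]
  · filter_upwards [continuous_subtype_val.continuousAt.eventually hu] with h hh
    refine Prod.ext ?_ ?_
    · show h.1.1 * P h.1 = _
      rw [hPg h hh, inversePairs_mul_mul_fst]
    · show Ring.inverse (W h.1) * P h.1 * h.1.2 = _
      rw [hWg h hh, hPg h hh, Ring.inverse_one, one_mul, h.2.2]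

/-- Retract both factors to arrows, then repair composability: the conjugator `V` moves the target
of the second arrow onto the source of the first, and the first arrow is left alone. On composable
pairs near `c` the two idempotents already agree, so `V = 1` and nothing moves. -/
theorem hasLocalRetractions_composable :
    HasLocalRetractions (fun c : (inversePairsGroupoid A).composable => (c.1.1.1, c.1.2.1)) := by
  intro c
  obtain ⟨r, ⟨ρ, hρ, hrρ⟩, hr⟩ := hasLocalRetractions_inversePairs A c.1.1
  obtain ⟨s, ⟨σ, hσ, hsσ⟩, hs⟩ := hasLocalRetractions_inversePairs A c.1.2
  set e₀ : (A × A) × (A × A) := (c.1.1.1, c.1.2.1) with he₀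
  have hι : IsEmbedding (fun c : (inversePairsGroupoid A).composable => (c.1.1.1, c.1.2.1)) :=
    (IsEmbedding.subtypeVal.prodMap IsEmbedding.subtypeVal).comp .subtypeVal
  have hρ' : AnalyticAt ℝ (fun e : (A × A) × (A × A) => ρ e.1) e₀ :=
    AnalyticAt.fun_comp (f := fun e : (A × A) × (A × A) => e.1) hρ analyticAt_fst
  have hσ' : AnalyticAt ℝ (fun e : (A × A) × (A × A) => σ e.2) e₀ :=
    AnalyticAt.fun_comp (f := fun e : (A × A) × (A × A) => e.2) hσ analyticAt_snd
  have f1 : ∀ {f : (A × A) × (A × A) → A × A}, AnalyticAt ℝ f e₀ →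
      AnalyticAt ℝ (fun e => (f e).1) e₀ := fun hf => analyticAt_fst.comp hf
  have f2 : ∀ {f : (A × A) × (A × A) → A × A}, AnalyticAt ℝ f e₀ →
      AnalyticAt ℝ (fun e => (f e).2) e₀ := fun hf => analyticAt_snd.comp hf
  let V : (A × A) × (A × A) → A := fun e =>
    idempotentConjugator ((ρ e.1).2 * (ρ e.1).1) ((σ e.2).1 * (σ e.2).2)
  have hV : AnalyticAt ℝ V e₀ :=
    ((f2 hρ').mul (f1 hρ')).idempotentConjugator ((f1 hσ').mul (f2 hσ'))
  have hfix : ∀ᶠ d : (inversePairsGroupoid A).composable in 𝓝 c,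
      ρ d.1.1.1 = d.1.1.1 ∧ σ d.1.2.1 = d.1.2.1 := by
    have t1 : Tendsto (fun d : (inversePairsGroupoid A).composable => d.1.1) (𝓝 c) (𝓝 c.1.1) :=
      (continuous_fst.comp continuous_subtype_val).tendsto c
    have t2 : Tendsto (fun d : (inversePairsGroupoid A).composable => d.1.2) (𝓝 c) (𝓝 c.1.2) :=
      (continuous_snd.comp continuous_subtype_val).tendsto c
    have v1 : Tendsto (Subtype.val : inversePairs A → A × A) (𝓝 c.1.1) (𝓝 c.1.1.1) :=
      continuous_subtype_val.tendsto _
    have v2 : Tendsto (Subtype.val : inversePairs A → A × A) (𝓝 c.1.2) (𝓝 c.1.2.1) :=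
      continuous_subtype_val.tendsto _
    filter_upwards [t1.eventually (hr.and (v1.eventually hrρ)),
      t2.eventually (hs.and (v2.eventually hsσ))] with d h1 h2
    exact ⟨h1.2.symm.trans (congrArg _ h1.1), h2.2.symm.trans (congrArg _ h2.1)⟩
  have hV1 : ∀ d : (inversePairsGroupoid A).composable,
      ρ d.1.1.1 = d.1.1.1 ∧ σ d.1.2.1 = d.1.2.1 → V (d.1.1.1, d.1.2.1) = 1 := by
    intro d hd
    have h3 : d.1.1.1.2 * d.1.1.1.1 = d.1.2.1.1 * d.1.2.1.2 := congrArg Subtype.val d.2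
    simp only [V, hd.1, hd.2, h3]
    exact idempotentConjugator_self ((inversePairsGroupoid A).target d.1.2).2
  have hVu : IsUnit (V e₀) := by rw [he₀, hV1 c hfix.self_of_nhds]; exact isUnit_one
  refine exists_retraction_of_eventually hι
    (ρ := fun e => (ρ e.1, (V e * (σ e.2).1, (σ e.2).2 * Ring.inverse (V e))))
    (hρ'.prod ((hV.mul (f1 hσ')).prod ((f2 hσ').mul (hV.ringInverse hVu)))) ?_ ?_
  · filter_upwards [hV.continuousAt.eventually_isUnit hVu,
      continuousAt_fst.eventually hrρ, continuousAt_snd.eventually hsσ] with e h1 h2 h3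
    have h2' : (r e.1).1 = ρ e.1 := h2
    have h3' : (s e.2).1 = σ e.2 := h3
    refine ⟨⟨(r e.1, ⟨_, mul_mem_inversePairs (s e.2).2 h1⟩), ?_⟩, ?_⟩
    · apply Subtype.ext
      show (r e.1).1.2 * (r e.1).1.1 =
        V e * (s e.2).1.1 * ((s e.2).1.2 * Ring.inverse (V e))
      have h4 := idempotentConjugator_conj ((inversePairsGroupoid A).source (r e.1)).2
        ((inversePairsGroupoid A).target (s e.2)).2
      simp only [inversePairsGroupoid_source_val, inversePairsGroupoid_target_val, h2', h3'] at h4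
      rw [h2', h3']
      refine (h4 h1).symm.trans ?_
      simp only [V, mul_assoc]
    · simp only [h2', h3']
  · filter_upwards [hfix] with d hd
    simp only [hV1 d hd, hd.1, hd.2, one_mul, Ring.inverse_one, mul_one]

end Analytic

/-! ### Topology and analytic structure of the groupoid. -/

section Topology

variable (A : Type u) [NormedRing A]

theorem isClosed_idempotents : IsClosed (idempotents A) :=
  isClosed_eq (by fun_prop) continuous_id

theorem isClosed_inversePairs : IsClosed (inversePairs A) :=
  (isClosed_eq (by fun_prop) continuous_fst).inter (isClosed_eq (by fun_prop) continuous_snd)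

theorem inversePairsGroupoid_continuous_source : Continuous (inversePairsGroupoid A).source :=
  Continuous.subtype_mk (by fun_prop) _

theorem inversePairsGroupoid_continuous_target : Continuous (inversePairsGroupoid A).target :=
  Continuous.subtype_mk (by fun_prop) _

theorem inversePairsGroupoid_continuous_inv : Continuous (inversePairsGroupoid A).inv :=
  Continuous.subtype_mk (by fun_prop) _

theorem inversePairsGroupoid_isHomeomorph_inv : IsHomeomorph (inversePairsGroupoid A).inv :=
  (Homeomorph.mk ⟨(inversePairsGroupoid A).inv, (inversePairsGroupoid A).inv,
    fun _ => rfl, fun _ => rfl⟩ (inversePairsGroupoid_continuous_inv A)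
    (inversePairsGroupoid_continuous_inv A)).isHomeomorph

theorem inversePairsGroupoid_source_surjective :
    Function.Surjective (inversePairsGroupoid A).source :=
  fun p => ⟨_, (inversePairsGroupoid A).source_one p⟩

theorem isEmbedding_isotropyOne : IsEmbedding
    (fun g : (inversePairsGroupoid A).isotropy (oneIdempotent A) => g.1.1) :=
  IsEmbedding.subtypeVal.comp .subtypeVal

end Topology

section Structure

variable {A : Type u} [NormedRing A] [NormedAlgebra ℝ A] [CompleteSpace A]

omit [CompleteSpace A] in
theorem analyticAt_mul_mul_swap (e : (A × A) × (A × A)) :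
    AnalyticAt ℝ (fun e : (A × A) × (A × A) => (e.1.1 * e.2.1, e.2.2 * e.1.2)) e := by
  have h1 : AnalyticAt ℝ (fun e : (A × A) × (A × A) => e.1) e := analyticAt_fst
  have h2 : AnalyticAt ℝ (fun e : (A × A) × (A × A) => e.2) e := analyticAt_snd
  exact ((analyticAt_fst.comp h1).mul (analyticAt_fst.comp h2)).prod
    ((analyticAt_snd.comp h2).mul (analyticAt_snd.comp h1))

/-- Through every arrow `g` there is a local analytic section of the source map, with constant
target. -/
theorem exists_source_section (g : inversePairs A) :
    ∃ s : idempotents A → inversePairs A,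
      AnalyticGermAt Subtype.val Subtype.val s ((inversePairsGroupoid A).source g) ∧
      s ((inversePairsGroupoid A).source g) = g ∧
      ∀ᶠ q in 𝓝 ((inversePairsGroupoid A).source g), (inversePairsGroupoid A).source (s q) = q ∧
        (inversePairsGroupoid A).target (s q) = (inversePairsGroupoid A).target g := by
  classical
  set p := (inversePairsGroupoid A).source g with hp
  have hpp : (p : A) * p = p := p.2
  have hu : ∀ᶠ q : idempotents A in 𝓝 p, IsUnit (idempotentConjugator (q : A) p) :=
    continuous_subtype_val.continuousAt.eventually (eventually_isUnit_idempotentConjugator hpp)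
  -- The section `q ↦ (a u⁻¹, u b)`, where `u` conjugates the source `p` of `g` to `q`. The value
  -- `g` for non-invertible `u` is irrelevant near `p`.
  let s : idempotents A → inversePairs A := fun q =>
    if h : IsUnit (idempotentConjugator (q : A) p) then
      ⟨_, mul_inverse_mem_inversePairs g.2 h⟩ else g
  have hs : ∀ q : idempotents A, IsUnit (idempotentConjugator (q : A) p) →
      (s q).1 = (g.1.1 * Ring.inverse (idempotentConjugator (q : A) p),
        idempotentConjugator (q : A) p * g.1.2) := fun q h => by simp only [s, dif_pos h]
  refine ⟨s, ⟨fun y => (g.1.1 * Ring.inverse (idempotentConjugator y p),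
    idempotentConjugator y p * g.1.2), ?_, hu.mono hs⟩, ?_, ?_⟩
  · have h : AnalyticAt ℝ (fun y : A => idempotentConjugator y p) p :=
      analyticAt_id.idempotentConjugator analyticAt_const
    exact (analyticAt_const.mul (h.ringInverse hu.self_of_nhds)).prod (h.mul analyticAt_const)
  · apply Subtype.ext
    rw [hs p hu.self_of_nhds, idempotentConjugator_self hpp]
    simp
  · filter_upwards [hu] with q hq
    constructor <;> apply Subtype.ext
    · rw [inversePairsGroupoid_source_val, hs q hq]
      refine Eq.trans ?_ (idempotentConjugator_conj q.2 hpp hq)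
      simp only [hp, inversePairsGroupoid_source_val, mul_assoc]
    · rw [inversePairsGroupoid_target_val, hs q hq, inversePairsGroupoid_target_val]
      show g.1.1 * Ring.inverse _ * (_ * g.1.2) = _
      rw [mul_assoc, ← mul_assoc (Ring.inverse _), Ring.inverse_mul_cancel _ hq, one_mul]

variable (A)

/-- The local section through `g` is continuous, so it lifts all objects near the source of `g` into
a given neighbourhood of `g`. -/
theorem inversePairsGroupoid_isOpenMap_source : IsOpenMap (inversePairsGroupoid A).source := by
  rw [isOpenMap_iff_nhds_le]
  intro g
  obtain ⟨s, hs, hsg, hsec⟩ := exists_source_section g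
  have hc : Tendsto s (𝓝 ((inversePairsGroupoid A).source g)) (𝓝 g) := by
    simpa only [ContinuousAt, hsg] using hs.continuousAt continuous_subtype_val .subtypeVal
  intro t ht
  filter_upwards [hc ht, hsec] with q h1 h2
  exact h2.1 ▸ h1

theorem inversePairsGroupoid_isLocallyTransitive : (inversePairsGroupoid A).IsLocallyTransitive := by
  intro p
  rw [isOpen_iff_mem_nhds]
  rintro _ ⟨g, hg, rfl⟩
  -- The section through the inverse of `g` has constant target `p`, and its sources fill a
  -- neighbourhood of the target of `g`. Inverting gives arrows from `p` to all these points.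
  obtain ⟨s, -, -, hsec⟩ := exists_source_section ((inversePairsGroupoid A).inv g)
  filter_upwards [hsec] with q hq
  exact ⟨(inversePairsGroupoid A).inv (s q), hq.2.trans hg, hq.1⟩

theorem inversePairsGroupoid_isTopologicalGroupoid :
    (inversePairsGroupoid A).IsTopologicalGroupoid where
  t2_base := inferInstance
  source_surjective := inversePairsGroupoid_source_surjective A
  source_continuous := inversePairsGroupoid_continuous_source A
  source_open := inversePairsGroupoid_isOpenMap_source A
  target_surjective p := ⟨_, (inversePairsGroupoid A).target_one p⟩
  target_continuous := inversePairsGroupoid_continuous_target A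
  -- The target is the source after inversion.
  target_open := (inversePairsGroupoid_isOpenMap_source A).comp
    (inversePairsGroupoid_isHomeomorph_inv A).isOpenMap
  mul_continuous := Continuous.subtype_mk (by fun_prop) _
  one_embedding := .of_leftInverse (f := (inversePairsGroupoid A).source)
    (inversePairsGroupoid A).source_one (inversePairsGroupoid_continuous_source A)
    (Continuous.subtype_mk (by fun_prop) _)
  inv_homeomorph := inversePairsGroupoid_isHomeomorph_inv A

/-- The manifold of idempotents. -/
noncomputable def idempotentsManifold : AnalyticBanachManifold.{u} (idempotents A) :=
  .ofLocalRetractions _ .subtypeVal (hasLocalRetractions_idempotents A)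

/-- The manifold of pairs of elements that are generalized inverses of each other. -/
noncomputable def inversePairsManifold : AnalyticBanachManifold.{u} (inversePairs A) :=
  .ofLocalRetractions _ .subtypeVal (hasLocalRetractions_inversePairs A)

theorem isAdapted_idempotentsManifold :
    (idempotentsManifold A).IsAdapted (Subtype.val : idempotents A → A) :=
  AnalyticBanachManifold.isAdapted_ofLocalRetractions _ _

theorem isAdapted_inversePairsManifold :
    (inversePairsManifold A).IsAdapted (Subtype.val : inversePairs A → A × A) :=
  AnalyticBanachManifold.isAdapted_ofLocalRetractions _ _

theorem inversePairsGroupoid_isAnalyticBanachLieGroupoid :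
    (inversePairsGroupoid A).IsAnalyticBanachLieGroupoid (inversePairsManifold A)
      (idempotentsManifold A) where
  topological := inversePairsGroupoid_isTopologicalGroupoid A
  t2_arrows := inferInstance
  source_submersion := by
    refine (isAdapted_inversePairsManifold A).isSubmersion (isAdapted_idempotentsManifold A)
      (inversePairsGroupoid_source_surjective A)
      (fun g => .of_forall (analyticAt_snd.mul analyticAt_fst) fun _ => rfl) fun g => ?_
    obtain ⟨s, hs, hsg, hsec⟩ := exists_source_section g
    exact ⟨s, hs, hsg, hsec.mono fun _ h => h.1⟩
  target_analytic := (isAdapted_inversePairsManifold A).isAnalyticMap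
    (isAdapted_idempotentsManifold A)
    fun g => .of_forall (analyticAt_fst.mul analyticAt_snd) fun _ => rfl
  one_analytic := (isAdapted_idempotentsManifold A).isAnalyticMap
    (isAdapted_inversePairsManifold A)
    fun p => .of_forall (analyticAt_id.prod analyticAt_id) fun _ => rfl
  inv_analytic := (isAdapted_inversePairsManifold A).isAnalyticMap
    (isAdapted_inversePairsManifold A)
    fun g => .of_forall (analyticAt_snd.prod analyticAt_fst) fun _ => rfl
  mul_analytic := by
    have hι : IsEmbedding
        (fun c : (inversePairsGroupoid A).composable => (c.1.1.1, c.1.2.1)) :=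
      (IsEmbedding.subtypeVal.prodMap IsEmbedding.subtypeVal).comp .subtypeVal
    have hM := AnalyticBanachManifold.isAdapted_ofLocalRetractions hι
      (hasLocalRetractions_composable A)
    have hG := isAdapted_inversePairsManifold A
    refine ⟨_, hM.isSubmanifold (hG.prod hG) ?_ (fun _ => rfl) (hasLocalRetractions_composable A),
      hM.isAnalyticMap hG fun _ => .of_forall (analyticAt_mul_mul_swap _) fun _ => rfl⟩
    exact isClosed_eq ((inversePairsGroupoid_continuous_source A).comp continuous_fst)
        ((inversePairsGroupoid_continuous_target A).comp continuous_snd)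

theorem isBanachLieGroup_ofUnits : (AnalyticBanachManifold.ofUnits A).IsBanachLieGroup where
  t2 := inferInstance
  analytic_mul := by
    have h := AnalyticBanachManifold.isAdapted_ofUnits A
    exact (h.prod h).isAnalyticMap h fun _ =>
      .of_forall (analyticAt_fst.mul analyticAt_snd) fun _ => rfl
  analytic_inv := by
    have h := AnalyticBanachManifold.isAdapted_ofUnits A
    exact h.isAnalyticMap h fun u =>
      .of_forall (analyticAt_inverse u) fun v => (Ring.inverse_unit v).symm

end Structure

/-! ### The isotropy group at the unit. -/

section Isotropy

variable (A : Type u) [Ring A]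

/-- The isotropy group at `1` is the group of units. -/
def isotropyOneEquivUnits :
    (inversePairsGroupoid A).isotropy (oneIdempotent A) ≃* Aˣ where
  toFun g := ⟨g.1.1.1, g.1.1.2, congrArg Subtype.val g.2.2, congrArg Subtype.val g.2.1⟩
  invFun u := ⟨⟨(u, (u⁻¹ : Aˣ)), by simp [inversePairs]⟩,
    Subtype.ext u.inv_mul, Subtype.ext u.mul_inv⟩
  left_inv _ := rfl
  right_inv _ := Units.ext rfl
  map_mul' _ _ := Units.ext rfl

end Isotropy

section IsotropyManifold

variable (A : Type u) [NormedRing A] [NormedAlgebra ℝ A] [CompleteSpace A]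

/-- Here `a b = b a = 1`, so the isotropy group is the graph of inversion on the units, and `(a, b)
↦ (a, a⁻¹)` retracts onto it wherever `a` is invertible. -/
theorem hasLocalRetractions_isotropyOne : HasLocalRetractions
    (fun g : (inversePairsGroupoid A).isotropy (oneIdempotent A) => g.1.1) := by
  intro g
  have hu : IsUnit g.1.1.1 := (isotropyOneEquivUnits A g).isUnit
  refine exists_retraction_of_eventually (isEmbedding_isotropyOne A)
    (ρ := fun e => (e.1, Ring.inverse e.1)) (analyticAt_fst.prod (analyticAt_fst.ringInverse hu))
    ?_ (Eventually.of_forall fun h => ?_)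
  · filter_upwards [continuousAt_fst.eventually_isUnit hu] with e ⟨v, hv⟩
    refine ⟨(isotropyOneEquivUnits A).symm v, ?_⟩
    rw [← hv, Ring.inverse_unit]
    rfl
  · exact Prod.ext rfl (Ring.inverse_unit (isotropyOneEquivUnits A h))

/-- The manifold structure of the isotropy group at `1`. -/
noncomputable def isotropyOneManifold :
    AnalyticBanachManifold.{u} ((inversePairsGroupoid A).isotropy (oneIdempotent A)) :=
  .ofLocalRetractions _ (isEmbedding_isotropyOne A) (hasLocalRetractions_isotropyOne A)

theorem isAdapted_isotropyOneManifold : (isotropyOneManifold A).IsAdapted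
    (fun g : (inversePairsGroupoid A).isotropy (oneIdempotent A) => g.1.1) :=
  AnalyticBanachManifold.isAdapted_ofLocalRetractions _ _

theorem isSubmanifold_isotropyOneManifold :
    (isotropyOneManifold A).IsSubmanifold (inversePairsManifold A) :=
  (isAdapted_isotropyOneManifold A).isSubmanifold (isAdapted_inversePairsManifold A)
    ((isClosed_eq (inversePairsGroupoid_continuous_source A) continuous_const).inter
      (isClosed_eq (inversePairsGroupoid_continuous_target A) continuous_const))
    (fun _ => rfl) (hasLocalRetractions_isotropyOne A)

theorem isBanachLieGroup_isotropyOneManifold : (isotropyOneManifold A).IsBanachLieGroup where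
  t2 := inferInstance
  analytic_mul := by
    have h := isAdapted_isotropyOneManifold A
    exact (h.prod h).isAnalyticMap h fun _ => .of_forall (analyticAt_mul_mul_swap _) fun _ => rfl
  analytic_inv := by
    have h := isAdapted_isotropyOneManifold A
    -- Inversion is the restriction of the coordinate swap.
    exact h.isAnalyticMap h fun _ =>
      .of_forall (analyticAt_snd.prod analyticAt_fst) fun _ => rfl

end IsotropyManifold

/-- For a unital Banach algebra `A`, the sets `Q(A) ⊆ A` and `𝒢(A) ⊆ A × A` are closed split real
analytic submanifolds, and with these manifold structures `𝒢(A) ⇉ Q(A)` is a real analytic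
Banach-Lie groupoid. It is locally transitive, and its isotropy group at `1` is a
submanifold of `𝒢(A)` and a Banach-Lie group isomorphic to `Aˣ` through `(a, b) ↦ a`. -/
theorem theorem7p3 (A : Type u) [NormedRing A] [NormedAlgebra ℝ A] [CompleteSpace A] :
    ∃ (MQ : AnalyticBanachManifold.{u} (idempotents A))
      (MG : AnalyticBanachManifold.{u} (inversePairs A)),
      MQ.IsSubmanifold (AnalyticBanachManifold.ofBanachSpace A) ∧
      MG.IsSubmanifold (AnalyticBanachManifold.ofBanachSpace (A × A)) ∧
      (inversePairsGroupoid A).IsAnalyticBanachLieGroupoid MG MQ ∧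
      (inversePairsGroupoid A).IsLocallyTransitive ∧
      (AnalyticBanachManifold.ofUnits A).IsBanachLieGroup ∧
      ∃ MI : AnalyticBanachManifold.{u} ((inversePairsGroupoid A).isotropy (oneIdempotent A)),
        MI.IsSubmanifold MG ∧ MI.IsBanachLieGroup ∧
        ∃ e : (inversePairsGroupoid A).isotropy (oneIdempotent A) ≃* Aˣ,
          (∀ g, ((e g : Aˣ) : A) = g.1.1.1 ∧ (((e g)⁻¹ : Aˣ) : A) = g.1.1.2) ∧
          MI.IsAnalyticMap (AnalyticBanachManifold.ofUnits A) e ∧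
          (AnalyticBanachManifold.ofUnits A).IsAnalyticMap MI e.symm := by
  have hQ := isAdapted_idempotentsManifold A
  have hG := isAdapted_inversePairsManifold A
  have hI := isAdapted_isotropyOneManifold A
  have hU := AnalyticBanachManifold.isAdapted_ofUnits A
  refine ⟨idempotentsManifold A, inversePairsManifold A,
    hQ.isSubmanifold (AnalyticBanachManifold.isAdapted_ofBanachSpace A) (isClosed_idempotents A)
      (fun _ => rfl) (hasLocalRetractions_idempotents A),
    hG.isSubmanifold (AnalyticBanachManifold.isAdapted_ofBanachSpace (A × A))
      (isClosed_inversePairs A) (fun _ => rfl) (hasLocalRetractions_inversePairs A),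
    inversePairsGroupoid_isAnalyticBanachLieGroupoid A, inversePairsGroupoid_isLocallyTransitive A,
    isBanachLieGroup_ofUnits A,
    isotropyOneManifold A, isSubmanifold_isotropyOneManifold A,
    isBanachLieGroup_isotropyOneManifold A, isotropyOneEquivUnits A, fun _ => ⟨rfl, rfl⟩,
    hI.isAnalyticMap hU fun _ => .of_forall analyticAt_fst fun _ => rfl,
    -- Analyticity of `a ↦ (a, a⁻¹)` is that of inversion in `A` at units.
    hU.isAnalyticMap hI fun u => .of_forall (analyticAt_id.prod (analyticAt_inverse u))
      fun v => Prod.ext rfl (Ring.inverse_unit v).symm⟩
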